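/- Let $W_0,W_1,\ldots$ be the numbering of all recursively enumerable (r.e.) subsets of $\mathbb N$ given by a fixed acceptable numbering of the partial recursive functions. A *positive equivalence relation* is an r.e. equivalence relation $\eta$ on $\mathbb N$ with infinitely many equivalence classes. A set is *$\eta$-finite* (*$\eta$-infinite*) if it is the union of finitely many, possibly zero (of infinitely many) $\eta$-equivalence classes, and *$\eta$-closed* if it is one of the two. An *$\eta$-family* is an infinite family of $\eta$-closed sets of the form $\{W_i : i\in S\}$, where $S$ is an r.e. set and $W_i\ne W_j$ for distinct $i,j\in S$. A *text* for $L\subseteq\mathbb N$ is a map $T:\mathbb N\to\mathbb N\cup\{\#\}$ with $\operatorname{range}(T)\setminus\{\#\}=L$; $T[n]$ denotes $T(0),\ldots,T(n-1)$. A *learner* is a recursive function $M:(\mathbb N\cup\{\#\})^*\to\mathbb N\cup\{?\}$, where the hypothesis $e\in\mathbb N$ stands for the $\eta$-closure $[W_e]=\{y : y\mathrel{\eta}x \text{ for some } x\in W_e\}$ of $W_e$ and $?$ stands for no set. Let $F$ be an $\eta$-family. * $M$ *explanatorily learns* $F$ if for every $L\in F$ and every text $T$ for $L$ there is an $n$ such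 that $M(T[n])$ is a hypothesis for $L$ and $M(T[j])=M(T[n])$ for all $j\ge n$. * $M$ *confidently learns* $F$ if it explanatorily learns $F$ and, for every text $T$ for any subset of $\mathbb N$, there is an $n$ with $M(T[j])=M(T[n])$ for all $j\ge n$. * $M$ *behaviourally correctly learns* $F$ if for every $L\in F$ and every text $T$ for $L$ there is an $n$ such that $M(T[j])$ is a hypothesis for $L$ for all $j\ge n$. * $M$ *vacillatorily learns* $F$ if it behaviourally correctly learns $F$ and, for every $L\in F$ and every text $T$ for $L$, the set $\{M(T[n]) : n\ge 1\}$ is finite. $F$ is learnable in one of these senses if some learner learns it in that sense. **Theorem.** There is a positive equivalence relation $\vartheta$ with the following properties. 1. $\mathbb N$ is the only $\vartheta$-infinite r.e. set. 2. Every $\vartheta$-family contains an infinite ascending chain $B_0\subsetneq B_1\subsetneq\cdots$ of $\vartheta$-finite sets whose union is $\mathbb N$. Moreover, no $\vartheta$-family is confidently learnable, and every behaviourally correctly learnable $\vartheta$-family consists only of $\vartheta$-finite sets. 3. Every vacillatorily learnable $\vartheta$-family is explanatorily learnable. -/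

import Mathlib

namespace EtaLearning

/-- `W e` is the `e`-th recursively enumerable set: the domain of the `e`-th partial recursive
function in the (acceptable) numbering given by codes of partial recursive functions. -/
def W (e : ℕ) : Set ℕ := {x | ((Denumerable.ofNat Nat.Partrec.Code e).eval x).Dom}

/-- A set of natural numbers is recursively enumerable. -/
def IsRE (A : Set ℕ) : Prop := REPred fun x : ℕ => x ∈ A

/-- A positive equivalence relation: a recursively enumerable equivalence relation on `ℕ` which
has infinitely many equivalence classes. -/
def IsPositive (η : Setoid ℕ) : Prop :=
  REPred (fun p : ℕ × ℕ => η p.1 p.2) ∧ η.classes.Infinite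

/-- A set is `η`-finite if it is a union of finitely many (possibly zero) `η`-classes. -/
def EtaFinite (η : Setoid ℕ) (A : Set ℕ) : Prop :=
  ∃ C : Set (Set ℕ), C ⊆ η.classes ∧ C.Finite ∧ A = ⋃₀ C

/-- A set is `η`-infinite if it is a union of infinitely many `η`-classes. -/
def EtaInfinite (η : Setoid ℕ) (A : Set ℕ) : Prop :=
  ∃ C : Set (Set ℕ), C ⊆ η.classes ∧ C.Infinite ∧ A = ⋃₀ C

/-- A set is `η`-closed if it is `η`-finite or `η`-infinite. -/
def EtaClosed (η : Setoid ℕ) (A : Set ℕ) : Prop :=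
  EtaFinite η A ∨ EtaInfinite η A

/-- The `η`-closure of a set. -/
def etaClosure (η : Setoid ℕ) (A : Set ℕ) : Set ℕ := {y | ∃ x ∈ A, η y x}

/-- A family of sets is one-one r.e. if it is `{W i : i ∈ S}` for some r.e. set `S` on which
different indices give different sets. -/
def OneOneRE (F : Set (Set ℕ)) : Prop :=
  ∃ S : Set ℕ, IsRE S ∧ Set.InjOn W S ∧ F = W '' S

/-- An `η`-family: an infinite one-one r.e. family of `η`-closed sets. -/
def IsEtaFamily (η : Setoid ℕ) (F : Set (Set ℕ)) : Prop :=
  F.Infinite ∧ OneOneRE F ∧ ∀ L ∈ F, EtaClosed η L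

/-- `T` is a text for `L`; the value `none` is the pause symbol. -/
def IsText (T : ℕ → Option ℕ) (L : Set ℕ) : Prop := {x | ∃ n, T n = some x} = L

/-- The initial segment `T 0, …, T (n - 1)` of a text. -/
def initSeg (T : ℕ → Option ℕ) (n : ℕ) : List (Option ℕ) := (List.range n).map T

/-- A learner maps finite sequences of numbers and pauses to hypotheses, where the value `none`
(written `?` in the literature) means that no conjecture is made. Learners have to be
recursive, which is part of the learning criteria below. -/
abbrev Learner := List (Option ℕ) → Option ℕ

/-- The hypothesis `h` is an index of `L` in the hypothesis space that consists of the
`η`-closures of `W 0, W 1, …`; the value `none` is not an index of any set. -/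
def IsIndexOf (η : Setoid ℕ) (h : Option ℕ) (L : Set ℕ) : Prop :=
  ∃ e : ℕ, h = some e ∧ etaClosure η (W e) = L

/-- `M` explanatorily learns `F`. -/
def ExLearns (η : Setoid ℕ) (M : Learner) (F : Set (Set ℕ)) : Prop :=
  ∀ L ∈ F, ∀ T, IsText T L →
    ∃ n, IsIndexOf η (M (initSeg T n)) L ∧ ∀ j, n ≤ j → M (initSeg T j) = M (initSeg T n)

/-- `M` behaviourally correctly learns `F`. -/
def BCLearns (η : Setoid ℕ) (M : Learner) (F : Set (Set ℕ)) : Prop :=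
  ∀ L ∈ F, ∀ T, IsText T L → ∃ n, ∀ j, n ≤ j → IsIndexOf η (M (initSeg T j)) L

/-- `M` confidently learns `F`: it explanatorily learns `F` and converges on every text for
every set of natural numbers. -/
def ConfLearns (η : Setoid ℕ) (M : Learner) (F : Set (Set ℕ)) : Prop :=
  ExLearns η M F ∧
    ∀ (L : Set ℕ) (T : ℕ → Option ℕ), IsText T L →
      ∃ n, ∀ j, n ≤ j → M (initSeg T j) = M (initSeg T n)

/-- `M` vacillatorily learns `F`: it behaviourally correctly learns `F` and issues only finitely
many different hypotheses on every text for a member of `F`. -/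
def VacLearns (η : Setoid ℕ) (M : Learner) (F : Set (Set ℕ)) : Prop :=
  BCLearns η M F ∧
    ∀ L ∈ F, ∀ T, IsText T L → {h | ∃ n, 1 ≤ n ∧ M (initSeg T n) = h}.Finite

def ExLearnable (η : Setoid ℕ) (F : Set (Set ℕ)) : Prop :=
  ∃ M : Learner, Computable M ∧ ExLearns η M F

def BCLearnable (η : Setoid ℕ) (F : Set (Set ℕ)) : Prop :=
  ∃ M : Learner, Computable M ∧ BCLearns η M F

def ConfLearnable (η : Setoid ℕ) (F : Set (Set ℕ)) : Prop :=
  ∃ M : Learner, Computable M ∧ ConfLearns η M F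

def VacLearnable (η : Setoid ℕ) (F : Set (Set ℕ)) : Prop :=
  ∃ M : Learner, Computable M ∧ VacLearns η M F

end EtaLearning

/-!
Number the equivalence classes in the order of their first appearance, starting from equality, and
merge the class `j` into a class `i < j` whenever one of the first `(2 ^ j + 1) ^ 2` r.e. sets is
seen to meet the class `j` but not the class `i`. The first `j` classes come to rest, so infinitely
many classes survive, and the class numbers met by the `q`-th r.e. set are closed downwards above
every `j` with `q < (2 ^ j + 1) ^ 2`. Hence an r.e. set that meets infinitely many classes meets all
of them.

The r.e. sets are listed here as the sections of the sets `W e`, so that in a family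
`W (f 0), W (f 1), …` about `2 ^ k` members are initial segments above the same `k`. Such a segment
either contains all numbers below `k` or is determined by its part below `k`, so among `2 ^ k + 1`
different members one differs from `ℕ` and contains the first `k` classes. This gives the ascending
chain, and with it Gold's argument: on a suitable text for the union of the chain, a behaviourally
correct learner conjectures members of the chain beyond any bound.

A vacillatory learner issues bounded hypotheses on a text for `L`, and the bound is found in the
limit. A bound on some index of `L` yields a `k` above which `L` is an initial segment, and then
`L` is the closure of its part below the first missing number whose class number is at least `k`.
-/

namespace EtaLearning

open Filter Set
open Nat.Partrec (Code)

/-! ### Recursively enumerable sets -/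

theorem primrecRel_mem {α : Type*} [Primcodable α] : PrimrecRel fun (l : List α) a => a ∈ l :=
  (PrimrecRel.exists_mem_list Primrec.eq).of_eq fun l b => by simp

theorem rePred_exists {α : Type*} [Primcodable α] {P : α → ℕ → Prop}
    (h : ComputablePred fun p : α × ℕ => P p.1 p.2) : REPred fun a => ∃ n, P a n := by
  classical
  have hfind : Partrec fun a => Nat.rfind fun n => (Part.some (decide (P a n)) : Part Bool) :=
    Partrec.rfind h.decide.partrec
  refine hfind.dom_re.of_eq fun a => Nat.rfind_dom.trans ⟨?_, ?_⟩
  · rintro ⟨n, hn, -⟩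
    exact ⟨n, of_decide_eq_true (Part.mem_some_iff.1 hn).symm⟩
  · rintro ⟨n, hn⟩
    exact ⟨n, Part.mem_some_iff.2 (decide_eq_true hn).symm, fun _ => trivial⟩

theorem rePred_mem_W {f : ℕ → ℕ} (hf : Computable f) : REPred fun p : ℕ × ℕ => p.2 ∈ W (f p.1) :=
  (Code.eval_part.comp ((Computable.ofNat Code).comp (hf.comp Computable.fst))
    Computable.snd).dom_re

theorem isRE_W (e : ℕ) : IsRE (W e) :=
  (Code.eval_part.comp (Computable.const _) Computable.id).dom_re

theorem isRE_univ : IsRE univ := Partrec.some.dom_re.of_eq fun _ => by simp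

theorem exists_computable_index {α : Type*} [Primcodable α] {R : α → ℕ → Prop}
    (h : REPred fun p : α × ℕ => R p.1 p.2) :
    ∃ g : α → ℕ, Computable g ∧ ∀ a, W (g a) = {x | R a x} := by
  obtain ⟨c, hc⟩ := Code.exists_code.1 h
  refine ⟨fun a => Encodable.encode (c.curry (Encodable.encode a)),
    Computable.encode.comp
      (Code.primrec₂_curry.to_comp.comp (Computable.const c) Computable.encode), fun a => ?_⟩
  ext x
  simp [W, hc, Part.assert]

theorem IsRE.exists_W {A : Set ℕ} (h : IsRE A) : ∃ e, W e = A := by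
  obtain ⟨g, -, hg⟩ := exists_computable_index (R := fun (_ : Unit) x => x ∈ A)
    (Partrec.comp h Computable.snd)
  exact ⟨g (), hg ()⟩

/-- The elements of `W e` that show up within `s` steps of computation. -/
def enumW (e s : ℕ) : List ℕ :=
  (List.range s).filter fun x => (Code.evaln s (Denumerable.ofNat Code e) x).isSome

theorem mem_enumW_iff {e s x : ℕ} :
    x ∈ enumW e s ↔ ∃ y, y ∈ Code.evaln s (Denumerable.ofNat Code e) x := by
  simp only [enumW, List.mem_filter, List.mem_range, Option.isSome_iff_exists, Option.mem_def,
    and_iff_right_iff_imp]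
  exact fun ⟨y, hy⟩ => Code.evaln_bound hy

theorem lt_of_mem_enumW {e s x : ℕ} (h : x ∈ enumW e s) : x < s :=
  List.mem_range.1 (List.mem_filter.1 h).1

theorem enumW_mono (e : ℕ) {s t : ℕ} (hst : s ≤ t) : enumW e s ⊆ enumW e t := fun x hx => by
  obtain ⟨y, hy⟩ := mem_enumW_iff.1 hx
  exact mem_enumW_iff.2 ⟨y, Code.evaln_mono hst hy⟩

theorem exists_mem_enumW_iff {e x : ℕ} : (∃ s, x ∈ enumW e s) ↔ x ∈ W e := by
  simp only [mem_enumW_iff, W, mem_ofPred_eq, Part.dom_iff_mem, Code.evaln_complete]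
  exact exists_comm

theorem primrec_enumW : Primrec₂ enumW := by
  have hrel : PrimrecRel fun (x : ℕ) (p : ℕ × ℕ) =>
      (Code.evaln p.2 (Denumerable.ofNat Code p.1) x).isSome = true :=
    Primrec.eq.comp (Primrec.option_isSome.comp (Code.primrec_evaln.comp
      (((Primrec.snd.comp Primrec.snd).pair
        ((Primrec.ofNat Code).comp (Primrec.fst.comp Primrec.snd))).pair Primrec.fst)))
      (Primrec.const true)
  exact (hrel.listFilter.comp (Primrec.list_range.comp Primrec.snd) Primrec.id).of_eq
    fun p => by simp [enumW]

theorem IsRE.exists_computable_gt {S : Set ℕ} (hS : IsRE S) (hinf : S.Infinite) :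
    ∃ g : ℕ → ℕ, Computable g ∧ ∀ y, y < g y ∧ g y ∈ S := by
  obtain ⟨e, rfl⟩ := hS.exists_W
  have hP : PrimrecRel fun y c : ℕ => y < c.unpair.1 ∧ c.unpair.1 ∈ enumW e c.unpair.2 :=
    have hx : Primrec fun p : ℕ × ℕ => p.2.unpair.1 :=
      Primrec.fst.comp (Primrec.unpair.comp Primrec.snd)
    have hs : Primrec fun p : ℕ × ℕ => p.2.unpair.2 :=
      Primrec.snd.comp (Primrec.unpair.comp Primrec.snd)
    (Primrec.nat_lt.comp Primrec.fst hx).and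
      (primrecRel_mem.comp (primrec_enumW.comp (Primrec.const e) hs) hx)
  have hex : ∀ y, ∃ c : ℕ, y < c.unpair.1 ∧ c.unpair.1 ∈ enumW e c.unpair.2 := fun y => by
    obtain ⟨x, hx, hyx⟩ := hinf.exists_gt y
    obtain ⟨s, hs⟩ := exists_mem_enumW_iff.2 hx
    exact ⟨Nat.pair x s, by simpa using ⟨hyx, hs⟩⟩
  exact ⟨fun y => (Nat.find (hex y)).unpair.1,
    Computable.fst.comp (Computable.unpair.comp (Computable.find hP.computablePred hex)),
    fun y => (Nat.find_spec (hex y)).imp_right fun h => exists_mem_enumW_iff.1 ⟨_, h⟩⟩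

theorem IsRE.exists_strictMono_computable {S : Set ℕ} (hS : IsRE S) (hinf : S.Infinite) :
    ∃ f : ℕ → ℕ, Computable f ∧ StrictMono f ∧ ∀ t, f t ∈ S := by
  obtain ⟨g, hg, hgt⟩ := hS.exists_computable_gt hinf
  refine ⟨fun t => Nat.rec (g 0) (fun _ v => g v) t,
    Computable.nat_rec Computable.id (Computable.const _)
      (hg.comp (Computable.snd.comp Computable.snd)).to₂,
    strictMono_nat_of_lt_succ fun t => (hgt _).1, fun t => ?_⟩
  cases t <;> exact (hgt _).2

/-! ### Merging classes by priority -/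

section Construction

/-- The new number of the class numbered `n` when the class numbered `p.2` is merged into the one
numbered `p.1 < p.2` and the later classes move down by one. -/
def mergeClass (p : ℕ × ℕ) (n : ℕ) : ℕ :=
  if n < p.2 then n else if n = p.2 then p.1 else n - 1

/-- The number of the class of `x` after the merges in `H`, of which the latest comes first. -/
def classAfter (H : List (ℕ × ℕ)) (x : ℕ) : ℕ := H.foldr mergeClass x

theorem mergeClass_of_lt {p : ℕ × ℕ} {n : ℕ} (h : n < p.2) : mergeClass p n = n := if_pos h

theorem mergeClass_snd (p : ℕ × ℕ) : mergeClass p p.2 = p.1 := by simp [mergeClass]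

theorem mergeClass_of_gt {p : ℕ × ℕ} {n : ℕ} (h : p.2 < n) : mergeClass p n = n - 1 := by
  simp [mergeClass, h.not_gt, h.ne']

theorem mergeClass_le {p : ℕ × ℕ} (hp : p.1 < p.2) (n : ℕ) : mergeClass p n ≤ n := by
  grind [mergeClass]

theorem mergeClass_surjective (p : ℕ × ℕ) : (mergeClass p).Surjective := fun n => by
  rcases lt_or_ge n p.2 with h | h
  · exact ⟨n, mergeClass_of_lt h⟩
  · exact ⟨n + 1, mergeClass_of_gt (Nat.lt_succ_of_le h)⟩

theorem primrec_mergeClass : Primrec₂ mergeClass :=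
  have hj : Primrec fun q : (ℕ × ℕ) × ℕ => q.1.2 := Primrec.snd.comp Primrec.fst
  Primrec.ite (Primrec.nat_lt.comp Primrec.snd hj) Primrec.snd <|
    Primrec.ite (Primrec.eq.comp Primrec.snd hj) (Primrec.fst.comp Primrec.fst)
      (Primrec.pred.comp Primrec.snd)

theorem primrec_classAfter : Primrec₂ classAfter :=
  Primrec.list_foldr Primrec.fst Primrec.snd (primrec_mergeClass.comp₂
    (Primrec.fst.comp₂ Primrec₂.right) (Primrec.snd.comp₂ Primrec₂.right))

variable (V : ℕ → ℕ → List ℕ) (w : ℕ → ℕ)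

/-- At stage `s`, one of the first `w p.2` sets meets the class `p.2` but not the class
`p.1 < p.2`. Here `V q s` lists the elements of the `q`-th set that are known at stage `s`. -/
def RequiresMerge (s : ℕ) (H : List (ℕ × ℕ)) (p : ℕ × ℕ) : Prop :=
  p.1 < p.2 ∧ ∃ q < w p.2,
    p.2 ∈ (V q s).map (classAfter H) ∧ p.1 ∉ (V q s).map (classAfter H)

instance (s : ℕ) (H : List (ℕ × ℕ)) (p : ℕ × ℕ) : Decidable (RequiresMerge V w s H p) :=
  inferInstanceAs (Decidable (_ ∧ ∃ q < w p.2, _))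

/-- The pair of classes examined at stage `s`; every pair is examined at infinitely many stages. -/
def candidate (s : ℕ) : ℕ × ℕ := s.unpair.1.unpair

/-- The merges performed before stage `s`, the latest first. -/
def merges : ℕ → List (ℕ × ℕ)
  | 0 => []
  | s + 1 => if RequiresMerge V w s (merges s) (candidate s) then candidate s :: merges s
      else merges s

/-- The number of the class of `x` at stage `s`. -/
def stage (s x : ℕ) : ℕ := classAfter (merges V w s) x

/-- A merge is performed at stage `s`. -/
def Acts (s : ℕ) : Prop := RequiresMerge V w s (merges V w s) (candidate s)

/-- The number of the class of `x` in the limit. -/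
noncomputable def classNumber (x : ℕ) : ℕ := ⨅ s, stage V w s x

variable {V w}

theorem primrec_requiresMerge (hV : Primrec₂ V) (hw : Primrec w) :
    PrimrecPred fun x : (ℕ × List (ℕ × ℕ)) × ℕ × ℕ => RequiresMerge V w x.1.1 x.1.2 x.2 := by
  have hi : Primrec fun x : (ℕ × List (ℕ × ℕ)) × ℕ × ℕ => x.2.1 := Primrec.fst.comp Primrec.snd
  have hj : Primrec fun x : (ℕ × List (ℕ × ℕ)) × ℕ × ℕ => x.2.2 := Primrec.snd.comp Primrec.snd
  have hmap : Primrec₂ fun (q : ℕ) (x : (ℕ × List (ℕ × ℕ)) × ℕ × ℕ) =>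
      (V q x.1.1).map (classAfter x.1.2) :=
    Primrec.list_map
      (hV.comp Primrec.fst (Primrec.fst.comp (Primrec.fst.comp Primrec.snd)))
      (primrec_classAfter.comp (Primrec.snd.comp (Primrec.fst.comp
        (Primrec.snd.comp Primrec.fst))) Primrec.snd)
  have hwitness : PrimrecRel fun (q : ℕ) (x : (ℕ × List (ℕ × ℕ)) × ℕ × ℕ) =>
      x.2.2 ∈ (V q x.1.1).map (classAfter x.1.2) ∧
        x.2.1 ∉ (V q x.1.1).map (classAfter x.1.2) :=
    (primrecRel_mem.comp hmap (hj.comp Primrec.snd)).and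
      (primrecRel_mem.comp hmap (hi.comp Primrec.snd)).not
  exact ((Primrec.nat_lt.comp hi hj).and (hwitness.exists_mem_list.comp
    (Primrec.list_range.comp (hw.comp hj)) Primrec.id)).of_eq fun x => by
      simp only [RequiresMerge, List.mem_range, id_eq]

theorem primrec_stage (hV : Primrec₂ V) (hw : Primrec w) : Primrec₂ (stage V w) := by
  have hcand : Primrec fun x : ℕ × List (ℕ × ℕ) => candidate x.1 :=
    Primrec.unpair.comp (Primrec.fst.comp (Primrec.unpair.comp Primrec.fst))
  have hmerges : Primrec (merges V w) := by
    refine (Primrec.nat_rec₁ (f := fun s H => if RequiresMerge V w s H (candidate s) then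
      candidate s :: H else H) [] (Primrec.ite
        ((primrec_requiresMerge hV hw).comp (Primrec.id.pair hcand))
        (Primrec.list_cons.comp hcand Primrec.snd) Primrec.snd)).of_eq fun s => ?_
    induction s with
    | zero => rfl
    | succ s ih => simp only [merges, ← ih]
  exact primrec_classAfter.comp (hmerges.comp Primrec.fst) Primrec.snd

theorem stage_succ_of_acts {s : ℕ} (h : Acts V w s) (x : ℕ) :
    stage V w (s + 1) x = mergeClass (candidate s) (stage V w s x) := by
  rw [stage, merges, if_pos (show RequiresMerge .. from h)]
  rfl

theorem stage_succ_of_not_acts {s : ℕ} (h : ¬ Acts V w s) (x : ℕ) :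
    stage V w (s + 1) x = stage V w s x := by
  rw [stage, merges, if_neg (show ¬ RequiresMerge .. from h)]
  rfl

theorem stage_succ_of_lt {s x : ℕ} (h : Acts V w s → stage V w s x < (candidate s).2) :
    stage V w (s + 1) x = stage V w s x := by
  by_cases hs : Acts V w s
  · rw [stage_succ_of_acts hs, mergeClass_of_lt (h hs)]
  · exact stage_succ_of_not_acts hs x

theorem stage_antitone (x : ℕ) : Antitone fun s => stage V w s x :=
  antitone_nat_of_succ_le fun s => by
    by_cases hs : Acts V w s
    · exact (stage_succ_of_acts hs x).trans_le (mergeClass_le hs.1 _)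
    · exact (stage_succ_of_not_acts hs x).le

theorem stage_congr {s t x y : ℕ} (hst : s ≤ t) (h : stage V w s x = stage V w s y) :
    stage V w t x = stage V w t y := by
  induction t, hst using Nat.le_induction with
  | base => exact h
  | succ t _ ih =>
    by_cases ht : Acts V w t
    · rw [stage_succ_of_acts ht, stage_succ_of_acts ht, ih]
    · rw [stage_succ_of_not_acts ht, stage_succ_of_not_acts ht, ih]

theorem stage_surjective (s : ℕ) : (stage V w s).Surjective := by
  induction s with
  | zero => exact fun n => ⟨n, rfl⟩
  | succ s ih =>
    by_cases hs : Acts V w s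
    · rw [funext (stage_succ_of_acts hs)]
      exact (mergeClass_surjective _).comp ih
    · rwa [funext (stage_succ_of_not_acts hs)]

theorem exists_lt_stage_eq {s x i : ℕ} (hi : i < stage V w s x) :
    ∃ y < x, stage V w s y = i := by
  induction s generalizing i with
  | zero => exact ⟨i, hi, rfl⟩
  | succ s ih =>
    by_cases hs : Acts V w s
    · simp only [stage_succ_of_acts hs] at hi ⊢
      rcases lt_or_ge i (candidate s).2 with h | h
      · obtain ⟨y, hy, rfl⟩ := ih (hi.trans_le (mergeClass_le hs.1 _))
        exact ⟨y, hy, mergeClass_of_lt h⟩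
      · have hx : (candidate s).2 < stage V w s x :=
          h.trans_lt (hi.trans_le (mergeClass_le hs.1 _))
        rw [mergeClass_of_gt hx] at hi
        obtain ⟨y, hy, hyi⟩ := ih (Nat.add_lt_of_lt_sub hi)
        exact ⟨y, hy, by rw [hyi, mergeClass_of_gt (Nat.lt_succ_of_le h), Nat.succ_sub_one]⟩
    · simp only [stage_succ_of_not_acts hs] at hi ⊢
      exact ih hi

theorem eventually_stage_eq (x : ℕ) : ∀ᶠ s in atTop, stage V w s x = classNumber V w x := by
  have h := tendsto_atTop_ciInf (stage_antitone (V := V) (w := w) x) (OrderBot.bddBelow _)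
  rwa [nhds_discrete, tendsto_pure] at h

theorem classNumber_eq_iff {x y : ℕ} :
    classNumber V w x = classNumber V w y ↔ ∃ s, stage V w s x = stage V w s y := by
  constructor
  · intro h
    obtain ⟨s, hx, hy⟩ := ((eventually_stage_eq x).and (eventually_stage_eq y)).exists
    exact ⟨s, hx.trans (h.trans hy.symm)⟩
  · rintro ⟨s, h⟩
    obtain ⟨t, ⟨hx, hy⟩, hst⟩ :=
      (((eventually_stage_eq x).and (eventually_stage_eq y)).and (eventually_ge_atTop s)).exists
    rw [← hx, ← hy, stage_congr hst h]

theorem exists_lt_classNumber_eq {x i : ℕ} (hi : i < classNumber V w x) :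
    ∃ y < x, classNumber V w y = i := by
  obtain ⟨s, hs⟩ :=
    ((eventually_all_finite (finite_Iic x)).2 fun y _ =>
      eventually_stage_eq (V := V) (w := w) y).exists
  obtain ⟨y, hy, hyi⟩ := exists_lt_stage_eq (hi.trans_eq (hs x self_mem_Iic).symm)
  exact ⟨y, hy, (hs y (mem_Iic.2 hy.le)).symm.trans hyi⟩

theorem eventually_imp_of_eventually_persistent {p : ℕ → Prop}
    (h : ∀ᶠ s in atTop, p s → p (s + 1)) : ∀ᶠ s in atTop, p (s + 1) → p s := by
  obtain ⟨s₀, h⟩ := eventually_atTop.1 h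
  by_cases hp : ∃ s ≥ s₀, p s
  · obtain ⟨s, hs, hps⟩ := hp
    have hpt : ∀ t ≥ s, p t := Nat.le_induction hps fun t ht => h t (hs.trans ht)
    filter_upwards [eventually_ge_atTop s] with t ht _ using hpt t ht
  · filter_upwards [eventually_ge_atTop s₀] with t ht hpt
    exact absurd ⟨t + 1, ht.trans t.le_succ, hpt⟩ hp

/-- Once the classes below `n` are at rest, every merge of the class `n` into a class `i < n`
makes one more of the first `w n` sets meet the class `i`, which happens only finitely often. -/
theorem eventually_le_candidate (hV : ∀ q {s t}, s ≤ t → V q s ⊆ V q t) (n : ℕ) :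
    ∀ᶠ s in atTop, Acts V w s → n ≤ (candidate s).2 := by
  induction n with
  | zero => exact Eventually.of_forall fun _ _ => Nat.zero_le _
  | succ n ih =>
    have hmet : ∀ᶠ s in atTop, ∀ q ∈ Iio (w n), ∀ i ∈ Iio n,
        i ∈ (V q (s + 1)).map (stage V w (s + 1)) → i ∈ (V q s).map (stage V w s) := by
      refine (eventually_all_finite (finite_Iio _)).2 fun q _ =>
        (eventually_all_finite (finite_Iio _)).2 fun i hi =>
          eventually_imp_of_eventually_persistent (p := fun s => i ∈ (V q s).map (stage V w s)) ?_
      filter_upwards [ih] with s hs hmem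
      obtain ⟨x, hx, rfl⟩ := List.mem_map.1 hmem
      exact List.mem_map.2 ⟨x, hV q s.le_succ hx, stage_succ_of_lt fun h => hi.trans_le (hs h)⟩
    filter_upwards [ih, hmet] with s hle hmet hs
    refine Nat.succ_le_of_lt ((hle hs).lt_of_ne ?_)
    rintro rfl
    obtain ⟨hij, q, hq, hj, hi⟩ := id hs
    obtain ⟨x, hx, hxj⟩ := List.mem_map.1 hj
    refine hi (hmet q hq _ hij (List.mem_map.2 ⟨x, hV q s.le_succ hx, ?_⟩))
    rw [stage_succ_of_acts hs, stage, hxj, mergeClass_snd]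

theorem eventually_forall_stage_eq (hV : ∀ q {s t}, s ≤ t → V q s ⊆ V q t) (n : ℕ) :
    ∀ᶠ s in atTop, ∀ x, stage V w s x = n → classNumber V w x = n := by
  obtain ⟨s₀, h⟩ := eventually_atTop.1 (eventually_le_candidate (w := w) hV (n + 1))
  filter_upwards [eventually_ge_atTop s₀] with s hs x hx
  have hstay : ∀ t ≥ s, stage V w t x = n := Nat.le_induction hx fun t ht ih => by
    rw [stage_succ_of_lt fun ha => ih.trans_lt (h t (hs.trans ht) ha), ih]
  obtain ⟨t, hlim, ht⟩ := ((eventually_stage_eq x).and (eventually_ge_atTop s)).exists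
  exact hlim.symm.trans (hstay t ht)

theorem classNumber_surjective (hV : ∀ q {s t}, s ≤ t → V q s ⊆ V q t) :
    (classNumber V w).Surjective := by
  intro n
  obtain ⟨s, hs⟩ := (eventually_forall_stage_eq (w := w) hV n).exists
  obtain ⟨x, hx⟩ := stage_surjective s n
  exact ⟨x, hs x hx⟩

theorem mem_image_classNumber_of_lt (hV : ∀ q {s t}, s ≤ t → V q s ⊆ V q t) {q i j : ℕ}
    (hij : i < j) (hq : q < w j) (hj : j ∈ classNumber V w '' {x | ∃ s, x ∈ V q s}) :
    i ∈ classNumber V w '' {x | ∃ s, x ∈ V q s} := by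
  by_contra hi
  obtain ⟨x, ⟨s₁, hxs⟩, hxj⟩ := hj
  obtain ⟨s₀, hs₀⟩ := eventually_atTop.1
    (((eventually_le_candidate (w := w) hV (j + 1)).and (eventually_forall_stage_eq hV i)).and
      ((eventually_stage_eq x).and (eventually_ge_atTop s₁)))
  have hcand : candidate (Nat.pair (Nat.pair i j) s₀) = (i, j) := by simp [candidate]
  obtain ⟨⟨hle, hstay⟩, hx, hs⟩ := hs₀ (Nat.pair (Nat.pair i j) s₀) (Nat.right_le_pair _ _)
  refine (hle ?_).not_gt (by rw [hcand]; exact j.lt_succ_self)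
  rw [Acts, hcand]
  refine ⟨hij, q, hq, List.mem_map.2 ⟨x, hV q hs hxs, hx.trans hxj⟩, fun hmem => ?_⟩
  obtain ⟨y, hy, hyi⟩ := List.mem_map.1 hmem
  exact hi ⟨y, ⟨_, hy⟩, hstay y hyi⟩

end Construction

/-! ### A positive equivalence relation with uniformly initial r.e. sets -/

/-- The list `{x : ⟨t, x⟩ ∈ W e}`, where `q = ⟨e, t⟩`, as far as it is known at stage `s`. -/
def enumSection (q s : ℕ) : List ℕ :=
  (List.range s).filter fun x => Nat.pair q.unpair.2 x ∈ enumW q.unpair.1 s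

/-- A bound on all `Nat.pair e t` with `e ≤ k` and `t ≤ 2 ^ k`. -/
def mergeBound (k : ℕ) : ℕ := (2 ^ k + 1) ^ 2

theorem mem_enumSection_iff {q s x : ℕ} :
    x ∈ enumSection q s ↔ Nat.pair q.unpair.2 x ∈ enumW q.unpair.1 s := by
  simp only [enumSection, List.mem_filter, List.mem_range, decide_eq_true_eq,
    and_iff_right_iff_imp]
  exact fun h => (Nat.right_le_pair _ _).trans_lt (lt_of_mem_enumW h)

theorem enumSection_mono (q : ℕ) {s t : ℕ} (hst : s ≤ t) : enumSection q s ⊆ enumSection q t :=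
  fun _ hx => mem_enumSection_iff.2 (enumW_mono _ hst (mem_enumSection_iff.1 hx))

theorem primrec_enumSection : Primrec₂ enumSection := by
  have he : Primrec fun p : ℕ × ℕ × ℕ => p.2.1.unpair.1 :=
    Primrec.fst.comp (Primrec.unpair.comp (Primrec.fst.comp Primrec.snd))
  have ht : Primrec fun p : ℕ × ℕ × ℕ => p.2.1.unpair.2 :=
    Primrec.snd.comp (Primrec.unpair.comp (Primrec.fst.comp Primrec.snd))
  have hrel : PrimrecRel fun (x : ℕ) (p : ℕ × ℕ) =>
      Nat.pair p.1.unpair.2 x ∈ enumW p.1.unpair.1 p.2 :=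
    primrecRel_mem.comp (primrec_enumW.comp he (Primrec.snd.comp Primrec.snd))
      (Primrec₂.natPair.comp ht Primrec.fst)
  exact (hrel.listFilter.comp (Primrec.list_range.comp Primrec.snd) Primrec.id).of_eq
    fun p => by simp [enumSection]

theorem primrec_mergeBound : Primrec mergeBound := by
  have hpow : Primrec fun k => 2 ^ k :=
    (Primrec.nat_rec₁ (f := fun _ v => v * 2) 1
      (Primrec.nat_mul.comp Primrec.snd (Primrec.const 2))).of_eq fun k => by
        induction k with
        | zero => rfl
        | succ k ih => rw [pow_succ, ← ih]
  have hsucc := Primrec.succ.comp hpow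
  exact (Primrec.nat_mul.comp hsucc hsucc).of_eq fun k => (sq _).symm

theorem pair_lt_mergeBound {e t k : ℕ} (he : e ≤ k) (ht : t ≤ 2 ^ k) :
    Nat.pair e t < mergeBound k :=
  (Nat.pair_lt_max_add_one_sq e t).trans_le <| Nat.pow_le_pow_left
    (Nat.succ_le_succ (max_le (he.trans Nat.lt_two_pow_self.le) ht)) 2

/-- Above `k`, the set `I` is an initial segment of `ℕ`. -/
def InitialAbove (k : ℕ) (I : Set ℕ) : Prop := ∀ n ∈ I, k ≤ n → Iic n ⊆ I

/-- The class numbering `c` makes the r.e. sets of every uniform list `W (f 0), W (f 1), …`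
initial segments of `ℕ` above some `k`, which may be the same for as many as `2 ^ k` of them. -/
def UniformlyInitial (c : ℕ → ℕ) : Prop :=
  ∀ f : ℕ → ℕ, Computable f → ∃ e, ∀ t k, e ≤ k → t ≤ 2 ^ k → InitialAbove k (c '' W (f t))

/-- The classes of `ker c` are numbered in the order of their first appearance. -/
def InOrderOfAppearance (c : ℕ → ℕ) : Prop := ∀ x, ∀ i < c x, ∃ y < x, c y = i

theorem exists_enumSection_eq {f : ℕ → ℕ} (hf : Computable f) :
    ∃ e, ∀ t, {x | ∃ s, x ∈ enumSection (Nat.pair e t) s} = W (f t) := by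
  obtain ⟨e, he⟩ := IsRE.exists_W (A := {n | n.unpair.2 ∈ W (f n.unpair.1)})
    (Partrec.comp (rePred_mem_W hf) Computable.unpair)
  refine ⟨e, fun t => ?_⟩
  ext x
  simp [mem_enumSection_iff, exists_mem_enumW_iff, he]

theorem exists_uniformlyInitial :
    ∃ c : ℕ → ℕ, c.Surjective ∧ UniformlyInitial c ∧ InOrderOfAppearance c ∧
      (REPred fun p : ℕ × ℕ => c p.1 = c p.2) ∧
      ∃ a : ℕ → ℕ → ℕ, Primrec₂ a ∧ ∀ x, ∀ᶠ s in atTop, a s x = c x := by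
  have hstage := primrec_stage primrec_enumSection primrec_mergeBound
  refine ⟨classNumber enumSection mergeBound, classNumber_surjective enumSection_mono, ?_,
    fun x i => exists_lt_classNumber_eq, ?_, stage enumSection mergeBound, hstage,
    eventually_stage_eq⟩
  · intro f hf
    obtain ⟨e, he⟩ := exists_enumSection_eq hf
    refine ⟨e, fun t k hek ht n hn hkn i hin => ?_⟩
    rw [← he t] at hn ⊢
    rcases (mem_Iic.1 hin).eq_or_lt with rfl | hlt
    · exact hn
    · exact mem_image_classNumber_of_lt enumSection_mono hlt (pair_lt_mergeBound (hek.trans hkn)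
        (ht.trans (Nat.pow_le_pow_right two_pos hkn))) hn
  · have hP : ComputablePred fun p : (ℕ × ℕ) × ℕ =>
        stage enumSection mergeBound p.2 p.1.1 = stage enumSection mergeBound p.2 p.1.2 :=
      (Primrec.eq.comp (hstage.comp Primrec.snd (Primrec.fst.comp Primrec.fst))
        (hstage.comp Primrec.snd (Primrec.snd.comp Primrec.fst))).computablePred
    exact (rePred_exists (P := fun p s => stage _ _ s p.1 = stage _ _ s p.2) hP).of_eq
      fun p => classNumber_eq_iff.symm

/-! ### Closed sets and families -/

theorem etaClosure_ker (c : ℕ → ℕ) (A : Set ℕ) : etaClosure (Setoid.ker c) A = c ⁻¹' (c '' A) := by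
  ext y
  simp [etaClosure, Setoid.ker_def, eq_comm]

theorem classes_ker {c : ℕ → ℕ} (hc : c.Surjective) :
    (Setoid.ker c).classes = range fun n => c ⁻¹' {n} := by
  ext A
  constructor
  · rintro ⟨y, rfl⟩
    exact ⟨c y, rfl⟩
  · rintro ⟨n, rfl⟩
    obtain ⟨y, rfl⟩ := hc n
    exact ⟨y, rfl⟩

theorem injective_preimage_singleton {c : ℕ → ℕ} (hc : c.Surjective) :
    (fun n => c ⁻¹' {n}).Injective := fun _ _ h =>
  singleton_injective (hc.preimage_injective h)

theorem exists_subset_classes_iff {c : ℕ → ℕ} (hc : c.Surjective) {p : Set (Set ℕ) → Prop}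
    {A : Set ℕ} :
    (∃ C ⊆ (Setoid.ker c).classes, p C ∧ A = ⋃₀ C) ↔
      p ((fun n => c ⁻¹' {n}) '' (c '' A)) ∧ c ⁻¹' (c '' A) = A := by
  have hunion : ∀ I : Set ℕ, ⋃₀ ((fun n => c ⁻¹' {n}) '' I) = c ⁻¹' I := fun I => by
    rw [sUnion_image, biUnion_preimage_singleton]
  rw [classes_ker hc]
  constructor
  · rintro ⟨C, hC, hp, rfl⟩
    obtain ⟨I, rfl⟩ := subset_range_iff_exists_image_eq.1 hC
    rw [hunion, image_preimage_eq I hc]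
    exact ⟨hp, rfl⟩
  · exact fun ⟨hp, hA⟩ => ⟨_, image_subset_range _ _, hp, by rw [hunion, hA]⟩

theorem etaFinite_ker_iff {c : ℕ → ℕ} (hc : c.Surjective) {A : Set ℕ} :
    EtaFinite (Setoid.ker c) A ↔ (c '' A).Finite ∧ c ⁻¹' (c '' A) = A := by
  rw [EtaFinite, exists_subset_classes_iff hc,
    finite_image_iff (injective_preimage_singleton hc).injOn]

theorem etaInfinite_ker_iff {c : ℕ → ℕ} (hc : c.Surjective) {A : Set ℕ} :
    EtaInfinite (Setoid.ker c) A ↔ (c '' A).Infinite ∧ c ⁻¹' (c '' A) = A := by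
  rw [EtaInfinite, exists_subset_classes_iff hc,
    infinite_image_iff (injective_preimage_singleton hc).injOn]

theorem etaClosed_ker_iff {c : ℕ → ℕ} (hc : c.Surjective) {A : Set ℕ} :
    EtaClosed (Setoid.ker c) A ↔ c ⁻¹' (c '' A) = A := by
  rw [EtaClosed, etaFinite_ker_iff hc, etaInfinite_ker_iff hc, ← or_and_right]
  exact and_iff_right (Set.finite_or_infinite _)

theorem isPositive_ker {c : ℕ → ℕ} (hc : c.Surjective)
    (hre : REPred fun p : ℕ × ℕ => c p.1 = c p.2) : IsPositive (Setoid.ker c) := by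
  refine ⟨hre, ?_⟩
  rw [classes_ker hc]
  exact infinite_range_of_injective (injective_preimage_singleton hc)

theorem InitialAbove.eq_univ {k : ℕ} {I : Set ℕ} (h : InitialAbove k I) (hI : I.Infinite) :
    I = univ := eq_univ_of_forall fun n => by
  obtain ⟨m, hm, hlt⟩ := hI.exists_gt (max k n)
  exact h m hm ((le_max_left _ _).trans hlt.le) ((le_max_right k n).trans hlt.le)

theorem UniformlyInitial.image_eq_univ {c : ℕ → ℕ} (hu : UniformlyInitial c) {A : Set ℕ}
    (hA : IsRE A) (hinf : (c '' A).Infinite) : c '' A = univ := by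
  obtain ⟨i, rfl⟩ := hA.exists_W
  obtain ⟨e, he⟩ := hu _ (Computable.const i)
  exact (he 0 e le_rfl (Nat.zero_le _)).eq_univ hinf

theorem isRE_and_etaInfinite_iff {c : ℕ → ℕ} (hc : c.Surjective) (hu : UniformlyInitial c)
    {A : Set ℕ} : IsRE A ∧ EtaInfinite (Setoid.ker c) A ↔ A = univ := by
  rw [etaInfinite_ker_iff hc]
  constructor
  · rintro ⟨hre, hinf, hA⟩
    rw [← hA, hu.image_eq_univ hre hinf, preimage_univ]
  · rintro rfl
    rw [image_univ, hc.range_eq]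
    exact ⟨isRE_univ, infinite_univ, preimage_univ⟩

/-- A proper subset of `ℕ` that is an initial segment above `m` but does not contain `Iio m` is
determined by its elements below `m`. -/
theorem exists_Iio_subset_of_injOn {m : ℕ} {I : ℕ → Set ℕ} (hinj : InjOn I (Iic (2 ^ m)))
    (hI : ∀ t ≤ 2 ^ m, InitialAbove m (I t)) : ∃ t ≤ 2 ^ m, I t ≠ univ ∧ Iio m ⊆ I t := by
  classical
  by_contra! hno
  have hdetermined : ∀ t ≤ 2 ^ m,
      I t = if Iio m ⊆ I t then univ else I t ∩ Iio m := fun t ht => by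
    split_ifs with hsub
    · by_contra hne
      exact hno t ht hne hsub
    · refine (inter_eq_left.2 fun n hn => ?_).symm
      by_contra hmn
      exact hsub fun i hi => hI t ht n hn (not_lt.1 hmn)
        (mem_Iic.2 ((mem_Iio.1 hi).le.trans (not_lt.1 hmn)))
  have hmaps : ∀ t ∈ Finset.Iic (2 ^ m),
      (Finset.range m).filter (· ∈ I t) ∈ (Finset.range m).powerset := fun t _ =>
    Finset.mem_powerset.2 (Finset.filter_subset _ _)
  obtain ⟨s, hs, t, ht, hst, heq⟩ := Finset.exists_ne_map_eq_of_card_lt_of_maps_to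
    (by rw [Finset.card_powerset, Finset.card_range, Nat.card_Iic]; exact Nat.lt_succ_self _)
    hmaps
  have htrace : I s ∩ Iio m = I t ∩ Iio m := by
    ext n
    simpa [and_comm] using Finset.ext_iff.1 heq n
  rw [Finset.mem_Iic] at hs ht
  refine hst (hinj hs ht ?_)
  rw [hdetermined s hs, hdetermined t ht, ← inter_eq_right, ← inter_eq_right, htrace]

theorem IsEtaFamily.preimage_image {c : ℕ → ℕ} (hc : c.Surjective) {F : Set (Set ℕ)}
    (hF : IsEtaFamily (Setoid.ker c) F) {L : Set ℕ} (hL : L ∈ F) : c ⁻¹' (c '' L) = L :=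
  (etaClosed_ker_iff hc).1 (hF.2.2 L hL)

theorem IsEtaFamily.etaFinite {c : ℕ → ℕ} (hc : c.Surjective) (hu : UniformlyInitial c)
    {F : Set (Set ℕ)} (hF : IsEtaFamily (Setoid.ker c) F) {L : Set ℕ} (hL : L ∈ F)
    (hne : L ≠ univ) : EtaFinite (Setoid.ker c) L := by
  obtain ⟨S, -, -, hS⟩ := hF.2.1
  obtain ⟨e, -, rfl⟩ := hS ▸ hL
  exact (hF.2.2 _ hL).resolve_right fun hinf =>
    hne ((isRE_and_etaInfinite_iff hc hu).1 ⟨isRE_W e, hinf⟩)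

theorem IsEtaFamily.exists_computable_injective {η : Setoid ℕ} {F : Set (Set ℕ)}
    (hF : IsEtaFamily η F) :
    ∃ f : ℕ → ℕ, Computable f ∧ (fun t => W (f t)).Injective ∧ ∀ t, W (f t) ∈ F := by
  obtain ⟨hinf, ⟨S, hS, hinj, rfl⟩, -⟩ := hF
  obtain ⟨f, hf, hmono, hmem⟩ := hS.exists_strictMono_computable (hinf.of_image W)
  exact ⟨f, hf, fun s t h => hmono.injective (hinj (hmem s) (hmem t) h),
    fun t => mem_image_of_mem W (hmem t)⟩

theorem IsEtaFamily.exists_Iio_subset {c : ℕ → ℕ} (hc : c.Surjective) (hu : UniformlyInitial c)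
    {F : Set (Set ℕ)} (hF : IsEtaFamily (Setoid.ker c) F) (k : ℕ) :
    ∃ L ∈ F, L ≠ univ ∧ Iio k ⊆ c '' L := by
  obtain ⟨f, hf, hinj, hmem⟩ := hF.exists_computable_injective
  obtain ⟨e, he⟩ := hu f hf
  have himage : (fun t => c '' W (f t)).Injective := fun s t h => hinj <| by
    simpa only [hF.preimage_image hc (hmem _)] using congrArg (c ⁻¹' ·) h
  obtain ⟨t, -, hne, hsub⟩ := exists_Iio_subset_of_injOn (m := max e k) himage.injOn
    fun t ht => he t _ (le_max_left _ _) ht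
  refine ⟨W (f t), hmem t, fun h => hne ?_, (Iio_subset_Iio (le_max_right _ _)).trans hsub⟩
  rw [h, image_univ, hc.range_eq]

theorem IsEtaFamily.exists_chain {c : ℕ → ℕ} (hc : c.Surjective) (hu : UniformlyInitial c)
    {F : Set (Set ℕ)} (hF : IsEtaFamily (Setoid.ker c) F) :
    ∃ B : ℕ → Set ℕ, StrictMono B ∧ (∀ n, B n ∈ F) ∧ (∀ n, EtaFinite (Setoid.ker c) (B n)) ∧
      ⋃ n, B n = univ := by
  choose L hmem hne hsub using hF.exists_Iio_subset hc hu
  have hfin : ∀ k, EtaFinite (Setoid.ker c) (L k) := fun k => hF.etaFinite hc hu (hmem k) (hne k)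
  choose b hb using fun k => ((etaFinite_ker_iff hc).1 (hfin k)).1.bddAbove
  have hL : ∀ {k x}, c x < k → x ∈ L k := fun {k x} hx => by
    rw [← hF.preimage_image hc (hmem k)]
    exact hsub k hx
  let next : ℕ → ℕ := fun k => max k (b k) + 2
  have hnext : ∀ k, L k ⊂ L (next k) := fun k => by
    have hlt : ∀ {x}, x ∈ L k → c x < next k := fun hx => by
      have := hb k (mem_image_of_mem c hx)
      lia
    obtain ⟨x, hx⟩ := hc (b k + 1)
    refine (ssubset_iff_of_subset fun y hy => hL (hlt hy)).2 ⟨x, hL (by lia), fun hxk => ?_⟩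
    have := hb k (mem_image_of_mem c hxk)
    lia
  have hk : StrictMono fun n => next^[n] 0 := strictMono_nat_of_lt_succ fun n => by
    rw [Function.iterate_succ_apply']
    lia
  refine ⟨fun n => L (next^[n] 0), strictMono_nat_of_lt_succ fun n => ?_, fun n => hmem _,
    fun n => hfin _, eq_univ_of_forall fun x => mem_iUnion.2 ⟨c x + 1, hL (hk.le_apply)⟩⟩
  rw [Function.iterate_succ_apply']
  exact hnext _

/-! ### Texts and learners -/

/-- The set of the numbers that occur in a finite sequence, pauses being ignored. -/
def content (σ : List (Option ℕ)) : Set ℕ := {x | some x ∈ σ}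

theorem length_initSeg (T : ℕ → Option ℕ) (n : ℕ) : (initSeg T n).length = n := by simp [initSeg]

theorem take_initSeg (T : ℕ → Option ℕ) {m n : ℕ} (h : m ≤ n) :
    (initSeg T n).take m = initSeg T m := by
  simp [initSeg, ← List.map_take, List.take_range, h]

theorem initSeg_prefix (T : ℕ → Option ℕ) {m n : ℕ} (h : m ≤ n) :
    initSeg T m <+: initSeg T n :=
  take_initSeg T h ▸ List.take_prefix _ _

theorem mem_content_initSeg {T : ℕ → Option ℕ} {n x : ℕ} :
    x ∈ content (initSeg T n) ↔ ∃ i < n, T i = some x := by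
  simp [content, initSeg]

theorem content_mono {σ τ : List (Option ℕ)} (h : σ <+: τ) : content σ ⊆ content τ :=
  fun _ hx => h.subset hx

theorem finite_content (σ : List (Option ℕ)) : (content σ).Finite :=
  (List.finite_toSet σ).preimage (Option.some_injective ℕ).injOn

theorem IsText.iUnion_content {T : ℕ → Option ℕ} {L : Set ℕ} (hT : IsText T L) :
    ⋃ n, content (initSeg T n) = L := by
  rw [← hT]
  ext x
  simp only [mem_iUnion, mem_content_initSeg, mem_ofPred_eq]
  exact ⟨fun ⟨_, i, _, h⟩ => ⟨i, h⟩, fun ⟨i, h⟩ => ⟨i + 1, i, i.lt_succ_self, h⟩⟩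

theorem exists_isText_initSeg_eq {L : Set ℕ} {σ : List (Option ℕ)} (hσ : content σ ⊆ L) :
    ∃ T, IsText T L ∧ initSeg T σ.length = σ := by
  classical
  let T : ℕ → Option ℕ := fun i =>
    σ.getD i (if i - σ.length ∈ L then some (i - σ.length) else none)
  refine ⟨T, ?_, List.ext_getElem (length_initSeg _ _) fun i _ hi => ?_⟩
  · ext x
    constructor
    · rintro ⟨i, hi⟩
      rcases lt_or_ge i σ.length with hlt | hge
      · refine hσ (List.mem_of_getElem (h := hlt) ?_)
        simpa [T, hlt] using hi
      · have := (List.getD_eq_default σ _ hge).symm.trans hi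
        grind
    · refine fun hx => ⟨σ.length + x, ?_⟩
      simp [T, hx]
  · simp [initSeg, T, hi]

theorem exists_isText_initSeg_eq_of_prefix {σ : ℕ → List (Option ℕ)}
    (hσ : ∀ n, σ n <+: σ (n + 1)) (hlen : ∀ n, n ≤ (σ n).length) :
    ∃ T, IsText T (⋃ n, content (σ n)) ∧ ∀ n, initSeg T (σ n).length = σ n := by
  have hmono : ∀ {m n}, m ≤ n → σ m <+: σ n := fun {m n} h => by
    induction n, h using Nat.le_induction with
    | base => exact List.prefix_rfl
    | succ n _ ih => exact ih.trans (hσ n)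
  let T : ℕ → Option ℕ := fun i => (σ (i + 1))[i]'(hlen (i + 1))
  have hT : ∀ n i (hi : i < (σ n).length), T i = (σ n)[i] := fun n i hi => by
    rcases le_total n (i + 1) with h | h
    · exact ((hmono h).getElem hi).symm
    · exact (hmono h).getElem _
  refine ⟨T, ?_, fun n => List.ext_getElem (length_initSeg _ _) fun i _ hi => ?_⟩
  · ext x
    simp only [mem_ofPred_eq, mem_iUnion, content]
    constructor
    · exact fun ⟨i, hi⟩ => ⟨i + 1, hi ▸ List.getElem_mem _⟩
    · rintro ⟨n, hn⟩
      obtain ⟨i, hi, hx⟩ := List.mem_iff_getElem.1 hn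
      exact ⟨i, (hT n i hi).trans hx⟩
  · simp [initSeg, hT n i hi]

theorem exists_isText_forall_exists {L : Set ℕ} {P : ℕ → List (Option ℕ) → Prop}
    (h : ∀ n σ, content σ ⊆ L → ∃ τ, σ <+: τ ∧ content τ ⊆ L ∧ P n τ) :
    ∃ T, IsText T L ∧ ∀ n, ∃ j ≥ n, P n (initSeg T j) := by
  classical
  choose! extend hprefix hsub hP using h
  let datum : ℕ → Option ℕ := fun n => if n ∈ L then some n else none
  have hdatum : ∀ {n σ}, content σ ⊆ L → content (σ ++ [datum n]) ⊆ L := fun hσ x hx => by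
    rcases List.mem_append.1 hx with hx | hx
    · exact hσ hx
    · grind
  let σ : ℕ → List (Option ℕ) := fun n => Nat.rec [] (fun n τ => extend n (τ ++ [datum n])) n
  have hσ : ∀ n, content (σ n) ⊆ L := fun n => by
    induction n with
    | zero => exact fun x hx => absurd hx List.not_mem_nil
    | succ n ih => exact hsub n _ (hdatum ih)
  have hnext : ∀ n, σ n ++ [datum n] <+: σ (n + 1) := fun n => hprefix n _ (hdatum (hσ n))
  have hlen : ∀ n, n ≤ (σ n).length := fun n => by
    induction n with
    | zero => exact Nat.zero_le _
    | succ n ih =>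
      exact (Nat.succ_le_succ ih).trans (by simpa using (hnext n).length_le)
  obtain ⟨T, hT, hinit⟩ := exists_isText_initSeg_eq_of_prefix
    (fun n => (List.prefix_append _ _).trans (hnext n)) hlen
  have hunion : ⋃ n, content (σ n) = L :=
    (iUnion_subset hσ).antisymm fun x hx => mem_iUnion.2 ⟨x + 1,
      (hnext x).subset (List.mem_append_right _ (List.mem_singleton.2 (if_pos hx).symm))⟩
  refine ⟨T, hunion ▸ hT, fun n => ⟨(σ (n + 1)).length, n.le_succ.trans (hlen (n + 1)), ?_⟩⟩
  rw [hinit (n + 1)]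
  exact hP n _ (hdatum (hσ n))

theorem IsIndexOf.unique {η : Setoid ℕ} {h : Option ℕ} {L L' : Set ℕ} (hL : IsIndexOf η h L)
    (hL' : IsIndexOf η h L') : L = L' := by
  obtain ⟨e, rfl, rfl⟩ := hL
  obtain ⟨_, ⟨⟩, rfl⟩ := hL'
  rfl

theorem ExLearns.bcLearns {η : Setoid ℕ} {M : Learner} {F : Set (Set ℕ)} (hM : ExLearns η M F) :
    BCLearns η M F := fun L hL T hT =>
  (hM L hL T hT).imp fun _ hn j hj => by rw [hn.2 j hj]; exact hn.1

section AscendingChain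

variable {η : Setoid ℕ} {M : Learner} {F : Set (Set ℕ)} {B : ℕ → Set ℕ}

theorem BCLearns.exists_prefix_isIndexOf (hM : BCLearns η M F) {L : Set ℕ} (hL : L ∈ F)
    {σ : List (Option ℕ)} (hσ : content σ ⊆ L) :
    ∃ τ, σ <+: τ ∧ content τ ⊆ L ∧ IsIndexOf η (M τ) L := by
  obtain ⟨T, hT, hTσ⟩ := exists_isText_initSeg_eq hσ
  obtain ⟨n, hn⟩ := hM L hL T hT
  refine ⟨initSeg T (max n σ.length), ?_, ?_, hn _ (le_max_left _ _)⟩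
  · simpa only [hTσ] using initSeg_prefix T (le_max_right n σ.length)
  · rw [← hT.iUnion_content]
    exact subset_iUnion (fun n => content (initSeg T n)) _

theorem exists_ge_content_subset (hB : Monotone B) {σ : List (Option ℕ)}
    (hσ : content σ ⊆ ⋃ n, B n) (n : ℕ) : ∃ m ≥ n, content σ ⊆ B m := by
  choose! b hb using fun x (hx : x ∈ content σ) => mem_iUnion.1 (hσ hx)
  obtain ⟨m, hm⟩ := ((finite_content σ).image b).bddAbove
  exact ⟨max n m, le_max_left _ _, fun x hx =>
    hB ((hm (mem_image_of_mem b hx)).trans (le_max_right _ _)) (hb x hx)⟩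

theorem BCLearns.exists_isText_iUnion (hM : BCLearns η M F) (hB : Monotone B)
    (hBF : ∀ n, B n ∈ F) :
    ∃ T, IsText T (⋃ n, B n) ∧
      ∀ n, ∃ j ≥ n, ∃ m ≥ n, IsIndexOf η (M (initSeg T j)) (B m) := by
  refine exists_isText_forall_exists
    (P := fun n τ => ∃ m ≥ n, IsIndexOf η (M τ) (B m)) fun n σ hσ => ?_
  obtain ⟨m, hnm, hm⟩ := exists_ge_content_subset hB hσ n
  obtain ⟨τ, hτ, hsub, hindex⟩ := hM.exists_prefix_isIndexOf (hBF m) hm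
  exact ⟨τ, hτ, hsub.trans (subset_iUnion B m), m, hnm, hindex⟩

theorem BCLearns.iUnion_notMem (hM : BCLearns η M F) (hB : StrictMono B) (hBF : ∀ n, B n ∈ F) :
    ⋃ n, B n ∉ F := fun hF => by
  obtain ⟨T, hT, hchain⟩ := hM.exists_isText_iUnion hB.monotone hBF
  obtain ⟨n, hn⟩ := hM _ hF T hT
  obtain ⟨j, hj, m, -, hm⟩ := hchain n
  have hunion : B m = ⋃ n, B n := hm.unique (hn j hj)
  exact (hB m.lt_succ_self).not_ge ((subset_iUnion B (m + 1)).trans_eq hunion.symm)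

theorem not_confLearns_of_strictMono (hB : StrictMono B) (hBF : ∀ n, B n ∈ F) :
    ¬ ConfLearns η M F := fun hM => by
  obtain ⟨T, hT, hchain⟩ := hM.1.bcLearns.exists_isText_iUnion hB.monotone hBF
  obtain ⟨n, hn⟩ := hM.2 _ T hT
  obtain ⟨j, hj, m, -, hm⟩ := hchain n
  obtain ⟨j', hj', m', hmm', hm'⟩ := hchain (max n (m + 1))
  rw [hn j hj] at hm
  rw [hn j' ((le_max_left _ _).trans hj')] at hm'
  exact (hB (Nat.lt_of_succ_le ((le_max_right _ _).trans hmm'))).ne (hm.unique hm')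

end AscendingChain

/-! ### From vacillatory to explanatory learning -/

/-- The largest hypothesis that `M` issues on the initial segments of `σ`, where `?` counts
as `0`. -/
def hypothesisBound (M : Learner) (σ : List (Option ℕ)) : ℕ :=
  (Finset.range (σ.length + 1)).sup fun n => (M (σ.take n)).getD 0

theorem computable_hypothesisBound {M : Learner} (hM : Computable M) :
    Computable (hypothesisBound M) := by
  have hval : Computable fun p : List (Option ℕ) × ℕ × ℕ => (M (p.1.take p.2.1)).getD 0 :=
    (Primrec.option_getD.comp Primrec.id (Primrec.const 0)).to_comp.comp <|
      hM.comp (Primrec.list_take.comp (Primrec.fst.comp Primrec.snd) Primrec.fst).to_comp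
  have hrec : ∀ (σ : List (Option ℕ)) n,
      (Nat.rec 0 (fun i v => max ((M (σ.take i)).getD 0) v) n : ℕ) =
        (Finset.range n).sup fun i => (M (σ.take i)).getD 0 := fun σ n => by
    induction n with
    | zero => rfl
    | succ n ih => rw [Finset.range_add_one, Finset.sup_insert, ← ih]
  exact (Computable.nat_rec (Computable.succ.comp Computable.list_length) (Computable.const 0)
    (Primrec.nat_max.to_comp.comp hval (Computable.snd.comp Computable.snd)).to₂).of_eq
    fun σ => hrec σ (σ.length + 1)

theorem hypothesisBound_initSeg (M : Learner) (T : ℕ → Option ℕ) (s : ℕ) :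
    hypothesisBound M (initSeg T s) =
      (Finset.range (s + 1)).sup fun n => (M (initSeg T n)).getD 0 := by
  rw [hypothesisBound, length_initSeg]
  exact Finset.sup_congr rfl fun n hn => by
    rw [take_initSeg T (Nat.lt_succ_iff.1 (Finset.mem_range.1 hn))]

theorem exists_eventually_hypothesisBound_eq {M : Learner} {T : ℕ → Option ℕ}
    (hfin : {h | ∃ n, 1 ≤ n ∧ M (initSeg T n) = h}.Finite) :
    ∃ b, (∀ n, (M (initSeg T n)).getD 0 ≤ b) ∧
      ∀ᶠ s in atTop, hypothesisBound M (initSeg T s) = b := by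
  have hmono : Monotone fun s => hypothesisBound M (initSeg T s) := fun s t hst => by
    simp only [hypothesisBound_initSeg]
    exact Finset.sup_mono (Finset.range_mono (Nat.succ_le_succ hst))
  have hbdd : BddAbove (range fun s => hypothesisBound M (initSeg T s)) := by
    obtain ⟨b, hb⟩ := ((hfin.insert (M (initSeg T 0))).image fun h => h.getD 0).bddAbove
    refine ⟨b, forall_mem_range.2 fun s => ?_⟩
    rw [hypothesisBound_initSeg]
    refine Finset.sup_le fun n _ => hb (mem_image_of_mem _ ?_)
    rcases n.eq_zero_or_pos with rfl | hn
    · exact mem_insert _ _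
    · exact mem_insert_of_mem _ ⟨n, hn, rfl⟩
  refine ⟨⨆ s, hypothesisBound M (initSeg T s), fun n => le_trans ?_ (le_ciSup hbdd n), ?_⟩
  · rw [hypothesisBound_initSeg]
    exact Finset.le_sup (f := fun n => (M (initSeg T n)).getD 0) (Finset.self_mem_range_succ n)
  · have hlim := tendsto_atTop_ciSup hmono hbdd
    rwa [nhds_discrete, tendsto_pure] at hlim

/-- The least number absent from `σ` whose class has a number at least `k`, where `a s x` is the
number of the class of `x` at stage `s`. -/
def cut (a : ℕ → ℕ → ℕ) (k : ℕ) (σ : List (Option ℕ)) : ℕ :=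
  (List.range σ.length).findIdx fun x => k ≤ a σ.length x ∧ some x ∉ σ

/-- The elements of `σ` below the cut. -/
def core (a : ℕ → ℕ → ℕ) (k : ℕ) (σ : List (Option ℕ)) : List ℕ :=
  (List.range (cut a k σ)).filter fun x => some x ∈ σ

theorem primrec_cut {a : ℕ → ℕ → ℕ} (ha : Primrec₂ a) : Primrec₂ (cut a) := by
  have hlen : Primrec fun p : (ℕ × List (Option ℕ)) × ℕ => p.1.2.length :=
    Primrec.list_length.comp (Primrec.snd.comp Primrec.fst)
  have hpred : PrimrecPred fun p : (ℕ × List (Option ℕ)) × ℕ =>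
      p.1.1 ≤ a p.1.2.length p.2 ∧ some p.2 ∉ p.1.2 :=
    (Primrec.nat_le.comp (Primrec.fst.comp Primrec.fst) (ha.comp hlen Primrec.snd)).and
      (primrecRel_mem.comp (Primrec.snd.comp Primrec.fst)
        (Primrec.option_some.comp Primrec.snd)).not
  exact (Primrec.list_findIdx (Primrec.list_range.comp (Primrec.list_length.comp Primrec.snd))
    hpred.decide.to₂).to₂

theorem primrec_core {a : ℕ → ℕ → ℕ} (ha : Primrec₂ a) : Primrec₂ (core a) := by
  have hmem : PrimrecRel fun (x : ℕ) (σ : List (Option ℕ)) => some x ∈ σ :=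
    primrecRel_mem.comp Primrec.snd (Primrec.option_some.comp Primrec.fst)
  exact (hmem.listFilter.comp (Primrec.list_range.comp (primrec_cut ha)) Primrec.snd).to₂

theorem IsText.eventually_mem_iff {T : ℕ → Option ℕ} {L : Set ℕ} (hT : IsText T L) (x : ℕ) :
    ∀ᶠ s in atTop, (some x ∈ initSeg T s ↔ x ∈ L) := by
  have hsub : ∀ s, content (initSeg T s) ⊆ L := fun s =>
    hT.iUnion_content ▸ subset_iUnion (fun n => content (initSeg T n)) s
  by_cases hx : x ∈ L
  · obtain ⟨n, hn⟩ := mem_iUnion.1 (hT.iUnion_content ▸ hx)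
    filter_upwards [eventually_ge_atTop n] with s hs
    exact iff_of_true (content_mono (initSeg_prefix T hs) hn) hx
  · exact Eventually.of_forall fun s => iff_of_false (fun h => hx (hsub s h)) hx

theorem IsText.eventually_cut_eq {a : ℕ → ℕ → ℕ} {c : ℕ → ℕ}
    (ha : ∀ x, ∀ᶠ s in atTop, a s x = c x) {T : ℕ → Option ℕ} {L : Set ℕ} (hT : IsText T L)
    {k x : ℕ} (hx : IsLeast {x | k ≤ c x ∧ x ∉ L} x) :
    ∀ᶠ s in atTop, cut a k (initSeg T s) = x := by
  have hlimit : ∀ᶠ s in atTop, ∀ y ∈ Iic x, a s y = c y :=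
    (eventually_all_finite (finite_Iic x)).2 fun y _ => ha y
  have hmem : ∀ᶠ s in atTop, ∀ y ∈ Iic x, (some y ∈ initSeg T s ↔ y ∈ L) :=
    (eventually_all_finite (finite_Iic x)).2 fun y _ => hT.eventually_mem_iff y
  filter_upwards [hlimit, hmem, eventually_gt_atTop x] with s ha hmem hs
  have hiff : ∀ y ≤ x, (k ≤ a s y ∧ some y ∉ initSeg T s) ↔ k ≤ c y ∧ y ∉ L := fun y hy => by
    rw [ha y hy, hmem y hy]
  rw [cut, length_initSeg, List.findIdx_eq (by simpa using hs)]
  simp only [List.getElem_range, decide_eq_true_eq, decide_eq_false_iff_not]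
  exact ⟨(hiff x le_rfl).2 hx.1, fun y hy h => (hx.2 ((hiff y hy.le).1 h)).not_gt hy⟩

open Classical in
theorem IsText.eventually_core_eq {a : ℕ → ℕ → ℕ} {c : ℕ → ℕ}
    (ha : ∀ x, ∀ᶠ s in atTop, a s x = c x) {T : ℕ → Option ℕ} {L : Set ℕ} (hT : IsText T L)
    {k x : ℕ} (hx : IsLeast {x | k ≤ c x ∧ x ∉ L} x) :
    ∀ᶠ s in atTop, core a k (initSeg T s) = (List.range x).filter (· ∈ L) := by
  have hmem : ∀ᶠ s in atTop, ∀ y ∈ Iio x, (some y ∈ initSeg T s ↔ y ∈ L) :=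
    (eventually_all_finite (finite_Iio x)).2 fun y _ => hT.eventually_mem_iff y
  filter_upwards [hT.eventually_cut_eq ha hx, hmem] with s hcut hmem
  rw [core, hcut]
  exact List.filter_congr fun y hy => decide_eq_decide.2 (hmem y (List.mem_range.1 hy))

theorem InitialAbove.preimage_image_Iio_inter {c : ℕ → ℕ} (hord : InOrderOfAppearance c) {k x : ℕ}
    {L : Set ℕ} (hI : InitialAbove k (c '' L)) (hL : c ⁻¹' (c '' L) = L) (hk : k ≤ c x)
    (hx : x ∉ L) : c ⁻¹' (c '' (Iio x ∩ L)) = L := by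
  refine (preimage_mono (image_mono inter_subset_right)).trans_eq hL |>.antisymm fun y hy => ?_
  have hlt : c y < c x := by
    by_contra! hle
    have hmem : c x ∈ c '' L := hI _ (mem_image_of_mem c hy) (hk.trans hle) hle
    exact hx (hL ▸ hmem)
  obtain ⟨z, hzx, hz⟩ := hord x _ hlt
  have hzL : z ∈ L := hL ▸ ⟨y, hy, hz.symm⟩
  exact ⟨z, ⟨hzx, hzL⟩, hz⟩

theorem IsIndexOf.image_eq {c : ℕ → ℕ} (hc : c.Surjective) {h : Option ℕ} {L : Set ℕ}
    (hL : IsIndexOf (Setoid.ker c) h L) : ∃ e, h = some e ∧ c '' W e = c '' L := by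
  obtain ⟨e, rfl, rfl⟩ := hL
  exact ⟨e, rfl, by rw [etaClosure_ker, image_preimage_eq _ hc]⟩

theorem IsEtaFamily.etaFinite_of_bcLearns {c : ℕ → ℕ} (hc : c.Surjective)
    (hu : UniformlyInitial c) {F : Set (Set ℕ)} (hF : IsEtaFamily (Setoid.ker c) F) {M : Learner}
    (hM : BCLearns (Setoid.ker c) M F) {L : Set ℕ} (hL : L ∈ F) :
    EtaFinite (Setoid.ker c) L := by
  obtain ⟨B, hB, hBF, -, hunion⟩ := hF.exists_chain hc hu
  refine hF.etaFinite hc hu hL ?_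
  rintro rfl
  exact hM.iUnion_notMem hB hBF (hunion ▸ hL)

theorem exists_isLeast_notMem {c : ℕ → ℕ} (hc : c.Surjective) {L : Set ℕ}
    (hL : EtaFinite (Setoid.ker c) L) (k : ℕ) : ∃ x, IsLeast {x | k ≤ c x ∧ x ∉ L} x := by
  classical
  obtain ⟨n, hn, hkn⟩ := ((etaFinite_ker_iff hc).1 hL).1.infinite_compl.exists_gt k
  obtain ⟨x, rfl⟩ := hc n
  have hex : ∃ x, k ≤ c x ∧ x ∉ L := ⟨x, hkn.le, fun hx => hn (mem_image_of_mem c hx)⟩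
  exact ⟨Nat.find hex, Nat.isLeast_find hex⟩

/-- As `k` bounds the index `t` of `L`, beyond the class number `k` the class numbers of `L` form
an initial segment, so `L` is the closure of its part below any missing number of that kind. -/
theorem exLearnable_of_vacLearnable {c : ℕ → ℕ} {a : ℕ → ℕ → ℕ} (hc : c.Surjective)
    (hu : UniformlyInitial c) (hord : InOrderOfAppearance c) (ha : Primrec₂ a)
    (hlim : ∀ x, ∀ᶠ s in atTop, a s x = c x) {F : Set (Set ℕ)}
    (hF : IsEtaFamily (Setoid.ker c) F) (h : VacLearnable (Setoid.ker c) F) :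
    ExLearnable (Setoid.ker c) F := by
  classical
  obtain ⟨M, hM, hbc, hvac⟩ := h
  obtain ⟨e, he⟩ := hu id Computable.id
  obtain ⟨g, hg, hWg⟩ := exists_computable_index (R := fun (l : List ℕ) x => x ∈ l)
    primrecRel_mem.computablePred.to_re
  let k : List (Option ℕ) → ℕ := fun σ => max e (hypothesisBound M σ)
  have hk : Computable k :=
    Primrec.nat_max.to_comp.comp (Computable.const e) (computable_hypothesisBound hM)
  refine ⟨fun σ => some (g (core a (k σ) σ)), Computable.option_some.comp
    (hg.comp ((primrec_core ha).to_comp.comp hk Computable.id)), fun L hL T hT => ?_⟩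
  obtain ⟨b, hb, hbound⟩ := exists_eventually_hypothesisBound_eq (hvac L hL T hT)
  obtain ⟨x, hx⟩ := exists_isLeast_notMem hc (hF.etaFinite_of_bcLearns hc hu hbc hL) (max e b)
  have hinitial : InitialAbove (max e b) (c '' L) := by
    obtain ⟨n, hn⟩ := hbc L hL T hT
    obtain ⟨t, ht, htL⟩ := (hn n le_rfl).image_eq hc
    have htb : t ≤ b := by simpa [ht] using hb n
    exact htL ▸ he t _ (le_max_left e b)
      ((htb.trans (le_max_right e b)).trans Nat.lt_two_pow_self.le)
  have hcore : ∀ᶠ s in atTop, core a (k (initSeg T s)) (initSeg T s) =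
      (List.range x).filter (· ∈ L) := by
    filter_upwards [hbound, hT.eventually_core_eq hlim hx] with s hs hcore
    simpa only [k, hs] using hcore
  obtain ⟨n, hn⟩ := eventually_atTop.1 hcore
  have hW : W (g ((List.range x).filter (· ∈ L))) = Iio x ∩ L := by
    rw [hWg]
    ext y
    simp
  refine ⟨n, ⟨_, rfl, ?_⟩, fun j hj => by simp only [hn j hj, hn n le_rfl]⟩
  rw [hn n le_rfl, etaClosure_ker, hW]
  exact hinitial.preimage_image_Iio_inter hord (hF.preimage_image hc hL) hx.1.1 hx.1.2

end EtaLearning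

theorem theorem6p1 :
    ∃ ϑ : Setoid ℕ, EtaLearning.IsPositive ϑ ∧
      (∀ A : Set ℕ, (EtaLearning.IsRE A ∧ EtaLearning.EtaInfinite ϑ A) ↔ A = Set.univ) ∧
      ((∀ F : Set (Set ℕ), EtaLearning.IsEtaFamily ϑ F →
          ∃ B : ℕ → Set ℕ, StrictMono B ∧ (∀ n, B n ∈ F) ∧
            (∀ n, EtaLearning.EtaFinite ϑ (B n)) ∧ ⋃ n, B n = Set.univ) ∧
        (∀ F : Set (Set ℕ), EtaLearning.IsEtaFamily ϑ F → ¬ EtaLearning.ConfLearnable ϑ F) ∧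
        (∀ F : Set (Set ℕ), EtaLearning.IsEtaFamily ϑ F → EtaLearning.BCLearnable ϑ F →
          ∀ L ∈ F, EtaLearning.EtaFinite ϑ L)) ∧
      (∀ F : Set (Set ℕ), EtaLearning.IsEtaFamily ϑ F → EtaLearning.VacLearnable ϑ F →
        EtaLearning.ExLearnable ϑ F) := by
  obtain ⟨c, hc, hu, hord, hre, a, ha, hlim⟩ := EtaLearning.exists_uniformlyInitial
  refine ⟨Setoid.ker c, EtaLearning.isPositive_ker hc hre,
    fun A => EtaLearning.isRE_and_etaInfinite_iff hc hu,
    ⟨fun F hF => hF.exists_chain hc hu, ?_, ?_⟩,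
    fun F hF => EtaLearning.exLearnable_of_vacLearnable hc hu hord ha hlim hF⟩
  · rintro F hF ⟨M, -, hM⟩
    obtain ⟨B, hB, hBF, -⟩ := hF.exists_chain hc hu
    exact EtaLearning.not_confLearns_of_strictMono hB hBF hM
  · rintro F hF ⟨M, -, hM⟩ L hL
    exact hF.etaFinite_of_bcLearns hc hu hM hL
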